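/- **Completeness of the control strategy algorithm for total formulas.** *Systems and strategies.* An alternating transition system is a tuple $T=(Q,A,B,\to,O,H)$ with states $Q$, control labels $A$, a non-empty set $B$ of disturbance labels, a transition relation $\to\subseteq Q\times A\times B\times Q$, observations $O$ and $H:Q\to O$. It is finite if $Q,A,B$ are finite, and non-blocking if $\{q':q\xrightarrow{a,b}q'\}\neq\emptyset$ for all $q,a,b$. A control strategy is a function $f:Q^{+}\to A$, where $Q^+$ is the set of non-empty finite strings over $Q$; $Out(q,f)$ is the set of $\sigma\in Q^\omega$ with $\sigma[1]=q$ such that for all $i\ge 1$ there is $b\in B$ with $\sigma[i]\xrightarrow{f(\sigma[1]\cdots\sigma[i]),\,b}\sigma[i+1]$. *Formulas.* Let $\mathbb P$ be a finite set of atomic propositions. LTL$_{-X}(\mathbb P)$ formulas are $\varphi::=p\mid\neg\varphi\mid\varphi\wedge\varphi\mid\varphi\,\mathbf U\,\varphi$ with the usual semantics over words in $(2^{\mathbb P})^\omega$. For a valuation $\Pi:Q\to2^{\mathbb P}$, a sequence $\sigma\in Q^\omega$ satisfies $\varphi$ if $\Pi(\sigma[1])\Pi(\sigma[2])\cdots\models\varphi$.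 A formula $\varphi$ is total if some Büchi automaton over $2^{\mathbb P}$ with finitely many states, exactly one initial state, and exactly one successor of each state under each letter, accepts exactly the words satisfying $\varphi$. *Reactive plans.* For $q_0\in Q$, a reactive plan of $T$ from $q_0$ is a finite set of rules $(n,q_n,a_n,N_n)$, one for each plan state $n\in\{1,\dots,k\}$, $k\ge1$, with $q_n\in Q$, $a_n\in A$, $N_n\subseteq\{1,\dots,k\}$, $q_1=q_0$ and $\{q_j:j\in N_n\}=\{q':q_n\xrightarrow{a_n,b}q'\text{ for some }b\in B\}$ for every $n$. It generates $\sigma\in Q^\omega$ if there are $i_1=1,i_2,i_3,\dots$ with $i_{m+1}\in N_{i_m}$ and $q_{i_m}=\sigma[m]$ for all $m$. It satisfies $\varphi$ if it generates at least one sequence and all the sequences that it generates satisfy $\varphi$. A path from $i$ to $j$ is a string of at least two plan states with first element $i$ and last element $j$, each later element lying in $N_n$ for its predecessor $n$. *The control strategy algorithm.* On input $T,\varphi,\Pi$, run through all $q_0\in Q$ in some order. For each $q_0$ call a planner (Kabanza et al.'s algorithm) that returns a reactive plan of $T$ from $q_0$ satisfying $\varphi$ if there is one, and reports failure otherwise.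 If it reports failure, go on with the next $q_0$. If it returns a plan $RP$: 1. *Simplify.* Let $i$ be the least plan state for which there are both a path from $i$ to $i$ and a path from $1$ to $i$; let *suffix* and *prefix* be shortest such paths, respectively. For every $n$ and every $q$ labelling an element of $N_n$, keep exactly one $j\in N_n$ with $q_j=q$ and remove the others from $N_n$: keep a $j$ such that $n,j$ are consecutive in *prefix* if there is one, otherwise a $j$ such that $n,j$ are consecutive in *suffix* if there is one, otherwise any one. 2. *Extract a strategy.* From the simplified plan define $f_{RP}:Q^+\to A$ by $f_{RP}(s)=a_{i_m}$ if $|s|=m$ and there are $i_1=1,\dots,i_m$ with $i_{l+1}\in N_{i_l}$ for $l<m$ and $q_{i_l}=s[l]$ for $l\le m$ (such a string is unique), and $f_{RP}(s)=a_1$ otherwise. 3. Return $(q_0,f_{RP})$ and stop. If all $q_0$ have been tried without success, return "false". **Theorem.** Let $T$ be a finite, non-blocking alternating transition system, $\varphi$ an LTL$_{-X}(\mathbb P)$ formula and $\Pi:Q\to2^{\mathbb P}$ a valuation. Suppose that $\varphi$ is total and that there are a state $q$ and a control strategy $f:Q^{+}\to A$ such that every $\sigma\in Out(q,f)$ satisfies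 $\varphi$. Then, in whatever order the states are tried and whatever admissible choices are made, the control strategy algorithm returns an initial state $q'$ and a control strategy $f':Q^{+}\to A$ such that every $\sigma\in Out(q',f')$ satisfies $\varphi$; moreover, at least one run of the algorithm exists for every order. -/

import Mathlib

namespace ControlStrategy

/-- An alternating transition system with state set `Q`, control labels `A`, disturbance labels `B`
and observation set `O`. -/
structure AltTransSystem (Q A B O : Type*) where
  trans : Q → A → B → Q → Prop
  obs : Q → O

namespace AltTransSystem

variable {Q A B O : Type*}

/-- Finiteness: the sets of states, control labels and disturbance labels are finite. -/
def IsFinite (_T : AltTransSystem Q A B O) : Prop :=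
  Finite Q ∧ Finite A ∧ Finite B

/-- Every state has a successor under every pair of a control and a disturbance label. -/
def NonBlocking (T : AltTransSystem Q A B O) : Prop :=
  ∀ q a b, {q' | T.trans q a b q'}.Nonempty

end AltTransSystem

/-- Non-empty finite strings over `Q`. -/
abbrev NEString (Q : Type*) := {s : List Q // s ≠ []}

/-- A control strategy assigns a control label to every non-empty finite string of states. -/
abbrev Strategy (Q A : Type*) := NEString Q → A

/-- The non-empty initial segment `σ 0, …, σ i` of an infinite sequence. -/
def initialSegment {Q : Type*} (σ : ℕ → Q) (i : ℕ) : NEString Q :=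
  ⟨(List.range (i + 1)).map σ, by simp⟩

/-- The infinite outcomes of the strategy `f` from the state `q`. Infinite sequences are indexed
from `0`. -/
def AltTransSystem.Out {Q A B O : Type*} (T : AltTransSystem Q A B O) (q : Q) (f : Strategy Q A) :
    Set (ℕ → Q) :=
  {σ | σ 0 = q ∧ ∀ i, ∃ b, T.trans (σ i) (f (initialSegment σ i)) b (σ (i + 1))}

/-- LTL formulas without the next operator over the atomic propositions `P`. -/
inductive LTL (P : Type*) where
  | atom (p : P) : LTL P
  | neg (φ : LTL P) : LTL P
  | and (φ ψ : LTL P) : LTL P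
  | until (φ ψ : LTL P) : LTL P

/-- Satisfaction of a formula at position `i` of a word over the alphabet of subsets of `P`. -/
def LTL.SatAt {P : Type*} (w : ℕ → Set P) : LTL P → ℕ → Prop
  | .atom p, i => p ∈ w i
  | .neg φ, i => ¬ φ.SatAt w i
  | .and φ ψ, i => φ.SatAt w i ∧ ψ.SatAt w i
  | .until φ ψ, i => ∃ j, i ≤ j ∧ ψ.SatAt w j ∧ ∀ k, i ≤ k → k < j → φ.SatAt w k

/-- A word satisfies a formula when the formula holds at its first position. -/
def LTL.Holds {P : Type*} (w : ℕ → Set P) (φ : LTL P) : Prop :=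
  φ.SatAt w 0

/-- A sequence of states satisfies `φ` with respect to the valuation `val`. -/
def SeqSat {Q P : Type*} (val : Q → Set P) (σ : ℕ → Q) (φ : LTL P) : Prop :=
  φ.Holds (fun i => val (σ i))

/-- Büchi automata with input alphabet `L` and finitely many states. -/
structure BuchiAutomaton (L : Type*) where
  State : Type
  finite_state : Finite State
  initial : Set State
  trans : State → L → State → Prop
  accepting : Set State

namespace BuchiAutomaton

variable {L : Type*}

/-- An infinite sequence of automaton states is an accepted run. -/
def IsAcceptedRun (M : BuchiAutomaton L) (ρ : ℕ → M.State) : Prop :=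
  ρ 0 ∈ M.initial ∧ (∀ i, ∃ l, M.trans (ρ i) l (ρ (i + 1))) ∧
    ∃ x ∈ M.accepting, {i | ρ i = x}.Infinite

/-- An infinite word is accepted when it labels an accepted run. -/
def Accepts (M : BuchiAutomaton L) (w : ℕ → L) : Prop :=
  ∃ ρ : ℕ → M.State, M.IsAcceptedRun ρ ∧ ∀ i, M.trans (ρ i) (w i) (ρ (i + 1))

/-- Deterministic and complete: exactly one initial state, and exactly one successor of each state
under each letter. -/
def IsTotal (M : BuchiAutomaton L) : Prop :=
  (∃ x, M.initial = {x}) ∧ ∀ x l, ∃ y, {x' | M.trans x l x'} = {y}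

end BuchiAutomaton

/-- A formula is total when a total Büchi automaton accepts exactly the words satisfying it. -/
def LTL.IsTotal {P : Type*} (φ : LTL P) : Prop :=
  ∃ M : BuchiAutomaton (Set P), M.IsTotal ∧ ∀ w, M.Accepts w ↔ φ.Holds w

/-- A reactive agent: an initial world state and a transition function that returns, for each world
state, a list of triples (action, strictly positive duration, set of successors). -/
structure ReactiveAgent (Q A : Type*) where
  start : Q
  succ : Q → List (A × {d : ℝ // 0 < d} × Set Q)

namespace ReactiveAgent

variable {Q A : Type*}

/-- The action `a` can be executed in `q`. -/
def Executable (R : ReactiveAgent Q A) (q : Q) (a : A) : Prop :=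
  ∃ e ∈ R.succ q, e.1 = a

/-- The world state `q'` is a possible result of executing `a` in `q`. -/
def Step (R : ReactiveAgent Q A) (q : Q) (a : A) (q' : Q) : Prop :=
  ∃ e ∈ R.succ q, e.1 = a ∧ q' ∈ e.2.2

end ReactiveAgent

/-- The transition function of an alternating transition system: the entries are `(a, 1, W)`, where
`a` runs through the control labels and `W` is the set of states reached from `q` under `a` and some
disturbance label. -/
noncomputable def AltTransSystem.succ {Q A B O : Type*} [Fintype A] (T : AltTransSystem Q A B O)
    (q : Q) : List (A × {d : ℝ // 0 < d} × Set Q) :=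
  (Finset.univ : Finset A).toList.map
    (fun a => (a, ⟨1, one_pos⟩, {q' | ∃ b, T.trans q a b q'}))

/-- The reactive agent given by a system and one of its states. -/
noncomputable def AltTransSystem.agent {Q A B O : Type*} [Fintype A] (T : AltTransSystem Q A B O)
    (q : Q) : ReactiveAgent Q A :=
  ⟨q, T.succ⟩

/-- A finite non-empty table of situation control rules `(n, state n, act n, next n)`, one for each
plan state `n`. The plan states are numbered from `0`, and plan state `0` is the initial one. -/
structure ReactivePlan (Q A : Type*) where
  last : ℕ
  state : Fin (last + 1) → Q
  act : Fin (last + 1) → A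
  next : Fin (last + 1) → Finset (Fin (last + 1))

namespace ReactivePlan

variable {Q A : Type*}

/-- The table is a reactive plan of the agent `R`: it starts in the initial world state, prescribes
executable actions, and the labels of the successor plan states of `n` are exactly the possible
results of executing the action of `n` in the world state of `n`. -/
def IsPlanOf (RP : ReactivePlan Q A) (R : ReactiveAgent Q A) : Prop :=
  RP.state 0 = R.start ∧
  (∀ n, R.Executable (RP.state n) (RP.act n)) ∧
  (∀ n, ∀ j ∈ RP.next n, R.Step (RP.state n) (RP.act n) (RP.state j)) ∧
  (∀ n q', R.Step (RP.state n) (RP.act n) q' → ∃ j ∈ RP.next n, RP.state j = q')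

/-- The sequence `σ` of world states is a trajectory generated by the plan. -/
def Generates (RP : ReactivePlan Q A) (σ : ℕ → Q) : Prop :=
  ∃ ν : ℕ → Fin (RP.last + 1), ν 0 = 0 ∧ ∀ i, ν (i + 1) ∈ RP.next (ν i) ∧ RP.state (ν i) = σ i

/-- The plan generates a trajectory, and all trajectories that it generates satisfy `φ`. -/
def Satisfies {P : Type*} (RP : ReactivePlan Q A) (val : Q → Set P) (φ : LTL P) : Prop :=
  (∀ σ, RP.Generates σ → SeqSat val σ φ) ∧ ∃ σ, RP.Generates σ

/-- A finite path of the plan from `i` to `j`: a string of at least two plan states, each of which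
is followed by one of its successors. -/
def IsPath (RP : ReactivePlan Q A) (i j : Fin (RP.last + 1)) (s : List (Fin (RP.last + 1))) :
    Prop :=
  1 < s.length ∧ s.IsChain (fun m n => n ∈ RP.next m) ∧ s.head? = some i ∧ s.getLast? = some j

/-- A path from `i` to `j` of minimal length. -/
def IsShortestPath (RP : ReactivePlan Q A) (i j : Fin (RP.last + 1))
    (s : List (Fin (RP.last + 1))) : Prop :=
  RP.IsPath i j s ∧ ∀ t, RP.IsPath i j t → s.length ≤ t.length

/-- The search for a reachable cycle in the simplification procedure: it goes through the plan
states in increasing order and stops at the first one, `i`, that lies on a cycle and is reached by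
a path from the initial plan state; `pre` is a shortest path from the initial plan state to `i`, and
`suf` is a shortest path from `i` to `i`. -/
def FindsCycle (RP : ReactivePlan Q A) (pre suf : List (Fin (RP.last + 1))) : Prop :=
  ∃ i, RP.IsShortestPath i i suf ∧ RP.IsShortestPath 0 i pre ∧
    ∀ i' < i, ¬ ((∃ s, RP.IsPath i' i' s) ∧ ∃ s, RP.IsPath 0 i' s)

/-- The plan states `i` and `j` occur consecutively in `s`. -/
def Consecutive {α : Type*} (s : List α) (i j : α) : Prop :=
  ∃ n, s[n]? = some i ∧ s[n + 1]? = some j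

/-- `N'` is obtained from `next i` by keeping, for each world state `q` that labels some member, one
member `l` among those labelled by `q` and removing the others: an `l` with `i, l` consecutive in
`pre` if there is one, else an `l` with `i, l` consecutive in `suf` if there is one, else an
arbitrary one. -/
def IsPruning (RP : ReactivePlan Q A) (pre suf : List (Fin (RP.last + 1)))
    (i : Fin (RP.last + 1)) (N' : Finset (Fin (RP.last + 1))) : Prop :=
  N' ⊆ RP.next i ∧
  ∀ q, (∃ j ∈ RP.next i, RP.state j = q) →
    ∃ l ∈ RP.next i, RP.state l = q ∧
      (∀ j ∈ RP.next i, RP.state j = q → (j ∈ N' ↔ j = l)) ∧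
      (Consecutive pre i l ∨
        (¬ ∃ j ∈ RP.next i, RP.state j = q ∧ Consecutive pre i j) ∧
          (Consecutive suf i l ∨ ¬ ∃ j ∈ RP.next i, RP.state j = q ∧ Consecutive suf i j))

/-- `RP'` is a possible result of the simplification procedure on `RP`. The procedure is used only
on plans that generate a trajectory; these are the plans with a reachable cycle. -/
def SimplifiesTo (RP RP' : ReactivePlan Q A) : Prop :=
  ∃ pre suf, RP.FindsCycle pre suf ∧
    ∃ N' : Fin (RP.last + 1) → Finset (Fin (RP.last + 1)),
      (∀ i, RP.IsPruning pre suf i (N' i)) ∧ RP' = { RP with next := N' }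

open Classical in
/-- The loop that produces the value of the strategy: from the plan state `k`, follow the successor
labelled by the next world state of the string. If there is no such successor the action of the
initial plan state is returned; when the string is used up, the action of the current plan state
is returned. In a simplified plan the successor `j` is unique. -/
noncomputable def follow (RP : ReactivePlan Q A) : Fin (RP.last + 1) → List Q → A
  | k, [] => RP.act k
  | k, q :: s =>
    if h : ∃ j, j ∈ RP.next k ∧ RP.state j = q then RP.follow h.choose s else RP.act 0

open Classical in
/-- The control strategy generated by a (simplified) plan. -/
noncomputable def functionStrategy (RP : ReactivePlan Q A) : Strategy Q A := fun s =>
  if s.1.head s.2 = RP.state 0 then RP.follow 0 s.1.tail else RP.act 0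

end ReactivePlan

/-- The possible answers of the planning subroutine on the agent `R`, the formula `φ` and the
valuation `val`: it returns any reactive plan of `R` satisfying `φ`, and it reports failure (`none`)
only if there is no such plan. -/
inductive PlannerReturns {Q A P : Type*} (R : ReactiveAgent Q A) (φ : LTL P) (val : Q → Set P) :
    Option (ReactivePlan Q A) → Prop
  | found (RP : ReactivePlan Q A) (hplan : RP.IsPlanOf R) (hsat : RP.Satisfies val φ) :
      PlannerReturns R φ val (some RP)
  | failed (hno : ∀ RP : ReactivePlan Q A, RP.IsPlanOf R → ¬ RP.Satisfies val φ) :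
      PlannerReturns R φ val none

/-- The runs of the main loop of the control strategy algorithm: `AlgorithmReturns T φ val qs r`
says that the loop over the list `qs` of candidate initial states can end with the result `r`,
which is an initial state with a control strategy, or `none` for the answer "false". For each
candidate the planner is called; when it finds a plan, the plan is simplified, turned into
a strategy and returned; otherwise the loop goes on. -/
inductive AlgorithmReturns {Q A B O P : Type*} [Fintype A] (T : AltTransSystem Q A B O)
    (φ : LTL P) (val : Q → Set P) : List Q → Option (Q × Strategy Q A) → Prop
  | exhausted : AlgorithmReturns T φ val [] none
  | found (q₀ : Q) (qs : List Q) (RPkab RP : ReactivePlan Q A)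
      (hplan : PlannerReturns (T.agent q₀) φ val (some RPkab)) (hsimp : RPkab.SimplifiesTo RP) :
      AlgorithmReturns T φ val (q₀ :: qs) (some (q₀, RP.functionStrategy))
  | continue (q₀ : Q) (qs : List Q) (r : Option (Q × Strategy Q A))
      (hfail : PlannerReturns (T.agent q₀) φ val none) (hrest : AlgorithmReturns T φ val qs r) :
      AlgorithmReturns T φ val (q₀ :: qs) r

end ControlStrategy

namespace ControlStrategy

open Filter

/-! Totality of `φ` turns the control problem into a Büchi game on the finite product of the system
with a deterministic automaton. A strategy with unbounded memory that wins this game can be replaced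
by a positional one. By `Wins.mem_level`, each winning state lies in some level of an attractor to
the accepting states; playing so that the level drops until acceptance, without leaving the winning
region, is winning (`exists_positional`). The winning product states, with these actions, form a
finite reactive plan satisfying `φ` (`exists_plan`), so the planner cannot fail at `q` and the loop
cannot answer "false". Whatever is returned is correct. Simplification removes successors but keeps
one for every reachable world state, so the result is still a plan and generates no new trajectory.
Every outcome of the extracted strategy is generated by that plan (`generates_of_mem_out`). The
prefix and suffix matter only for the existence of a run: a plan that generates a trajectory has a
reachable cycle. -/

/-! ### Deterministic Büchi automata -/

/-- The run of a deterministic transition function from `x` on the word `w`. -/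
def detRun {X L : Type*} (δ : X → L → X) (x : X) (w : ℕ → L) : ℕ → X
  | 0 => x
  | n + 1 => δ (detRun δ x w n) (w n)

theorem detRun_succ' {X L : Type*} (δ : X → L → X) (x : X) (w : ℕ → L) (n : ℕ) :
    detRun δ x w (n + 1) = detRun δ (δ x (w 0)) (fun i => w (i + 1)) n := by
  induction n with
  | zero => rfl
  | succ n ih => rw [detRun, ih, detRun]

/-- A total Büchi automaton is given by a transition function, and it accepts a word when the unique
run visits the accepting set infinitely often. -/
theorem BuchiAutomaton.IsTotal.exists_detRun {L : Type*} {M : BuchiAutomaton L} (hM : M.IsTotal) :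
    ∃ (x₀ : M.State) (δ : M.State → L → M.State),
      ∀ w, M.Accepts w ↔ ∃ᶠ i in atTop, detRun δ x₀ w i ∈ M.accepting := by
  obtain ⟨⟨x₀, hx₀⟩, ht⟩ := hM
  choose δ hδ using ht
  have htr : ∀ x l y, M.trans x l y ↔ y = δ x l := fun x l y => by
    have := Set.ext_iff.1 (hδ x l) y
    simpa using this
  refine ⟨x₀, δ, fun w => ?_⟩
  have := M.finite_state
  rw [Nat.frequently_atTop_iff_infinite]
  constructor
  · rintro ⟨ρ, ⟨h0, -, x, hx, hinf⟩, hρ⟩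
    have hrun : ∀ i, ρ i = detRun δ x₀ w i := by
      intro i
      induction i with
      | zero => simpa [hx₀, detRun] using h0
      | succ i ih => rw [detRun, ← ih, ← htr]; exact hρ i
    refine hinf.mono fun i hi => ?_
    rw [Set.mem_ofPred_eq] at hi ⊢
    rwa [← hrun, hi]
  · intro hinf
    refine ⟨detRun δ x₀ w, ⟨by simp [hx₀, detRun], fun i => ⟨w i, (htr _ _ _).2 rfl⟩, ?_⟩,
      fun i => (htr _ _ _).2 rfl⟩
    -- Pigeonhole: if each accepting state were visited finitely often, so would be their finite
    -- union.
    by_contra! hcon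
    refine hinf ?_
    have : {i | detRun δ x₀ w i ∈ M.accepting} =
        ⋃ x ∈ M.accepting, {i | detRun δ x₀ w i = x} := by
      ext i; simp
    rw [this]
    exact (Set.toFinite _).biUnion hcon

/-! ### Strategies and their shifts -/

theorem initialSegment_zero {Q : Type*} (σ : ℕ → Q) :
    initialSegment σ 0 = ⟨[σ 0], by simp⟩ := rfl

theorem initialSegment_succ {Q : Type*} (σ : ℕ → Q) (i : ℕ) :
    initialSegment σ (i + 1) =
      ⟨σ 0 :: (initialSegment (fun n => σ (n + 1)) i).1, by simp⟩ := by
  apply Subtype.ext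
  simp [initialSegment, List.range_succ_eq_map, Function.comp_def]

/-- The strategy that remains of `f` after the state `q` has been visited. -/
def Strategy.shift {Q A : Type*} (f : Strategy Q A) (q : Q) : Strategy Q A :=
  fun s => f ⟨q :: s.1, by simp⟩

theorem Strategy.shift_initialSegment {Q A : Type*} (f : Strategy Q A) (σ : ℕ → Q) (i : ℕ) :
    f.shift (σ 0) (initialSegment (fun n => σ (n + 1)) i) = f (initialSegment σ (i + 1)) := by
  rw [initialSegment_succ]; rfl

/-! ### The Büchi game on the product of system and automaton. -/

section Game

variable {Q A B O X L : Type*}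

/-- The strategy `f` wins from the state `(q, x)` of the product of the system with a deterministic
automaton: the automaton run on every outcome visits `F` infinitely often. -/
def Wins (T : AltTransSystem Q A B O) (lab : Q → L) (δ : X → L → X) (F : Set X)
    (f : Strategy Q A) (v : Q × X) : Prop :=
  ∀ σ ∈ T.Out v.1 f, ∃ᶠ i in atTop, detRun δ v.2 (fun i => lab (σ i)) i ∈ F

/-- The states of the product that are controlled in `n` steps into accepting states, staying in the
winning region: at each state some action leads only to winning states that are accepting or belong
to the previous level. -/
def level (T : AltTransSystem Q A B O) (lab : Q → L) (δ : X → L → X) (F : Set X) :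
    ℕ → Set (Q × X)
  | 0 => ∅
  | n + 1 => {v | ∃ a, ∀ b q', T.trans v.1 a b q' →
      (∃ f, Wins T lab δ F f (q', δ v.2 (lab v.1))) ∧
        (δ v.2 (lab v.1) ∈ F ∨ (q', δ v.2 (lab v.1)) ∈ level T lab δ F n)}

variable {T : AltTransSystem Q A B O} {lab : Q → L} {δ : X → L → X} {F : Set X}

/-- Prepending `v.1` to an outcome of the shifted strategy gives an outcome of `f`, and one extra
initial position does not affect infinitely many visits. -/
theorem Wins.shift {f : Strategy Q A} {v : Q × X} (h : Wins T lab δ F f v) {b : B} {q' : Q}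
    (ht : T.trans v.1 (f ⟨[v.1], by simp⟩) b q') :
    Wins T lab δ F (f.shift v.1) (q', δ v.2 (lab v.1)) := by
  rintro σ ⟨h0, hσ⟩
  have key := h (fun n => Nat.casesOn n v.1 σ) ⟨rfl, fun i => by
    cases i with
    | zero => exact ⟨b, by simpa [initialSegment_zero, h0] using ht⟩
    | succ i =>
      obtain ⟨b', hb'⟩ := hσ i
      refine ⟨b', ?_⟩
      have e := f.shift_initialSegment (fun n => Nat.casesOn n v.1 σ) i
      rw [← e]
      exact hb'⟩
  rw [Nat.frequently_atTop_iff_infinite] at key ⊢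
  by_contra hfin
  rw [Set.not_infinite] at hfin
  refine key (((hfin.image Nat.succ).insert 0).subset ?_)
  rintro (_ | i) hi
  · simp
  · right
    refine ⟨i, ?_, rfl⟩
    rw [Set.mem_ofPred_eq, detRun_succ'] at hi
    exact hi

theorem level_mono : Monotone (level T lab δ F) := by
  refine monotone_nat_of_le_succ fun n => ?_
  induction n with
  | zero => exact Set.empty_subset _
  | succ n ih =>
    rintro v ⟨a, ha⟩
    exact ⟨a, fun b q' ht => ⟨(ha b q' ht).1, (ha b q' ht).2.imp_right fun h => ih h⟩⟩

/-- From a winning state outside all levels a play consistent with the winning strategy could avoid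
the accepting states forever. -/
theorem Wins.mem_level [Finite Q] {f : Strategy Q A} {v : Q × X} (h : Wins T lab δ F f v) :
    ∃ n, v ∈ level T lab δ F n := by
  by_contra hv
  have step : ∀ p : {p : Strategy Q A × Q × X // Wins T lab δ F p.1 p.2 ∧
      ¬ ∃ n, p.2 ∈ level T lab δ F n}, ∃ q' : Q,
      (∃ b, T.trans p.1.2.1 (p.1.1 ⟨[p.1.2.1], by simp⟩) b q') ∧
      δ p.1.2.2 (lab p.1.2.1) ∉ F ∧
      Wins T lab δ F (p.1.1.shift p.1.2.1) (q', δ p.1.2.2 (lab p.1.2.1)) ∧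
        ¬ ∃ n, (q', δ p.1.2.2 (lab p.1.2.1)) ∈ level T lab δ F n := by
    rintro ⟨⟨g, q, x⟩, hg, hn⟩
    by_contra! hcon
    -- If every such successor had a level, finiteness of `Q` would bound these levels by some `M`,
    -- which would put the current state in level `M + 1`.
    have hl : ∀ q' : Q, ∃ n, ∀ b, T.trans q (g ⟨[q], by simp⟩) b q' →
        δ x (lab q) ∈ F ∨ (q', δ x (lab q)) ∈ level T lab δ F n := by
      intro q'
      by_cases hb : (∃ b, T.trans q (g ⟨[q], by simp⟩) b q') ∧ δ x (lab q) ∉ F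
      · obtain ⟨⟨b, hb⟩, hF⟩ := hb
        obtain ⟨n, hn⟩ := hcon q' ⟨b, hb⟩ hF (hg.shift hb)
        exact ⟨n, fun _ _ => Or.inr hn⟩
      · exact ⟨0, fun b hb' => Or.inl (by_contra fun hF => hb ⟨⟨b, hb'⟩, hF⟩)⟩
    choose N hN using hl
    obtain ⟨M, hM⟩ := (Set.finite_range N).bddAbove
    exact hn ⟨M + 1, g ⟨[q], by simp⟩, fun b q' ht => ⟨⟨_, hg.shift ht⟩,
      (hN q' b ht).imp_right fun h => level_mono (hM ⟨q', rfl⟩) h⟩⟩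
  choose nxt h1 h2 h3 using step
  let play : ℕ → {p : Strategy Q A × Q × X // Wins T lab δ F p.1 p.2 ∧
      ¬ ∃ n, p.2 ∈ level T lab δ F n} := fun n => Nat.rec ⟨(f, v), h, hv⟩
    (fun _ p => ⟨(p.1.1.shift p.1.2.1, nxt p, δ p.1.2.2 (lab p.1.2.1)), h3 p⟩) n
  let σ : ℕ → Q := fun n => (play n).1.2.1
  -- The strategy left after `i` moves, on the history since then, agrees with `f` on the whole
  -- history; hence the play is an outcome of `f`.
  have hstr : ∀ i j, (play i).1.1 (initialSegment (fun n => σ (n + i)) j) =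
      f (initialSegment σ (i + j)) := by
    intro i
    induction i with
    | zero => intro j; simp [play]
    | succ i ih =>
      intro j
      have e := Strategy.shift_initialSegment (play i).1.1 (fun n => σ (n + i)) j
      rw [ih (j + 1)] at e
      rw [show i + 1 + j = i + (j + 1) by omega, ← e]
      simp only [zero_add, show ∀ n, n + 1 + i = n + (i + 1) from fun n => by omega]
      rfl
  have hrun : ∀ i, (play i).1.2.2 = detRun δ v.2 (fun i => lab (σ i)) i := by
    intro i
    induction i with
    | zero => rfl
    | succ i ih => rw [detRun, ← ih]
  have hacc := h σ ⟨rfl, fun i => by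
    obtain ⟨b, hb⟩ := h1 (play i)
    refine ⟨b, ?_⟩
    have e := hstr i 0
    simp only [initialSegment_zero, zero_add, add_zero] at e
    rw [← e]
    exact hb⟩
  -- A visit at a positive time is needed: the initial automaton state itself may be accepting.
  obtain ⟨m, hm, hmF⟩ := (frequently_atTop.1 hacc) 1
  obtain ⟨k, rfl⟩ : ∃ k, m = k + 1 := ⟨m - 1, by omega⟩
  rw [← hrun] at hmF
  exact h2 (play k) hmF

/-- Positional winning strategies: an action for every state of the product, with a rank that
decreases along the successors of a winning state until an accepting state is reached. -/
theorem exists_positional [Nonempty A] [Finite Q] (T : AltTransSystem Q A B O) (lab : Q → L)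
    (δ : X → L → X) (F : Set X) :
    ∃ (act : Q × X → A) (rank : Q × X → ℕ), ∀ v, (∃ f, Wins T lab δ F f v) → ∀ b q',
      T.trans v.1 (act v) b q' → (∃ f, Wins T lab δ F f (q', δ v.2 (lab v.1))) ∧
        (δ v.2 (lab v.1) ∈ F ∨ rank (q', δ v.2 (lab v.1)) < rank v) := by
  have key : ∀ v, ∃ a, (∃ f, Wins T lab δ F f v) → ∀ b q', T.trans v.1 a b q' →
      (∃ f, Wins T lab δ F f (q', δ v.2 (lab v.1))) ∧ (δ v.2 (lab v.1) ∈ F ∨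
        sInf {n | (q', δ v.2 (lab v.1)) ∈ level T lab δ F n} <
          sInf {n | v ∈ level T lab δ F n}) := by
    intro v
    by_cases hv : ∃ f, Wins T lab δ F f v
    -- The rank is the least level containing the state; the action witnessing membership in that
    -- level is the one to play.
    · have hmem : v ∈ level T lab δ F (sInf {n | v ∈ level T lab δ F n}) :=
        Nat.sInf_mem (hv.elim fun _ hf => hf.mem_level)
      generalize sInf {n | v ∈ level T lab δ F n} = n at hmem ⊢
      cases n with
      | zero => exact hmem.elim
      | succ n =>
        obtain ⟨a, ha⟩ := hmem
        exact ⟨a, fun _ b q' ht => ⟨(ha b q' ht).1,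
          (ha b q' ht).2.imp_right fun h => Nat.lt_succ_of_le (Nat.sInf_le h)⟩⟩
    · exact ⟨Classical.arbitrary A, fun h => (hv h).elim⟩
  choose act hact using key
  exact ⟨act, fun v => sInf {n | v ∈ level T lab δ F n}, hact⟩

end Game

/-! ### Plans from winning strategies -/

theorem AltTransSystem.agent_executable {Q A B O : Type*} [Fintype A] (T : AltTransSystem Q A B O)
    (q₀ q : Q) (a : A) : (T.agent q₀).Executable q a :=
  ⟨(a, ⟨1, one_pos⟩, {q' | ∃ b, T.trans q a b q'}), by
    simp [AltTransSystem.agent, AltTransSystem.succ], rfl⟩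

theorem AltTransSystem.agent_step {Q A B O : Type*} [Fintype A] (T : AltTransSystem Q A B O)
    (q₀ q : Q) (a : A) (q' : Q) : (T.agent q₀).Step q a q' ↔ ∃ b, T.trans q a b q' := by
  simp [ReactiveAgent.Step, AltTransSystem.agent, AltTransSystem.succ]

/-- Numbers the plan states so that the initial product state becomes plan state `0`. -/
theorem exists_fin_equiv {α : Type*} [Finite α] (a : α) :
    ∃ (n : ℕ) (e : Fin (n + 1) ≃ α), e 0 = a := by
  obtain ⟨m, ⟨e⟩⟩ := Finite.exists_equiv_fin α
  cases m with
  | zero => exact (e a).elim0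
  | succ n => exact ⟨n, (Equiv.swap 0 (e a)).trans e.symm, by simp⟩

/-- Along a sequence in which the rank decreases unless the next term is good, infinitely many terms
are good. -/
theorem frequently_of_rank {P : ℕ → Prop} {r : ℕ → ℕ} (h : ∀ i, P (i + 1) ∨ r (i + 1) < r i) :
    ∃ᶠ i in atTop, P i := by
  intro hev
  obtain ⟨N, hN⟩ := eventually_atTop.1 hev
  have hlt : ∀ i, r (N + (i + 1)) < r (N + i) := fun i =>
    (h (N + i)).resolve_left (hN _ (by omega))
  exact (RelEmbedding.natGT (fun i => r (N + i)) hlt).not_wellFounded wellFounded_lt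

/-- A finite system with a strategy enforcing a total formula has a reactive plan satisfying it. -/
theorem exists_plan {Q A B O P : Type*} [Fintype A] [Nonempty B] [Finite Q]
    (T : AltTransSystem Q A B O) (hnb : T.NonBlocking) (φ : LTL P) (val : Q → Set P)
    (hφ : φ.IsTotal) (q : Q) (f : Strategy Q A) (hf : ∀ σ ∈ T.Out q f, SeqSat val σ φ) :
    ∃ RP : ReactivePlan Q A, RP.IsPlanOf (T.agent q) ∧ RP.Satisfies val φ := by
  classical
  obtain ⟨M, hM, hMφ⟩ := hφ
  obtain ⟨x₀, δ, hδ⟩ := hM.exists_detRun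
  have := M.finite_state
  have : Nonempty A := ⟨f ⟨[q], by simp⟩⟩
  have hsat : ∀ σ, SeqSat val σ φ ↔
      ∃ᶠ i in atTop, detRun δ x₀ (fun i => val (σ i)) i ∈ M.accepting := fun σ => by
    rw [← hδ, hMφ]; rfl
  obtain ⟨act, rank, hact⟩ := exists_positional T val δ M.accepting
  -- The plan states are the winning product states: the automaton component is all the memory
  -- required.
  let W := {v : Q × M.State // ∃ g, Wins T val δ M.accepting g v}
  let w₀ : W := ⟨(q, x₀), f, fun σ hσ => (hsat σ).1 (hf σ hσ)⟩
  obtain ⟨n, e, he⟩ := exists_fin_equiv w₀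
  let R : W → W → Prop := fun v v' =>
    (∃ b, T.trans v.1.1 (act v.1) b v'.1.1) ∧ v'.1.2 = δ v.1.2 (val v.1.1)
  let RP : ReactivePlan Q A :=
    { last := n
      state := fun k => (e k).1.1
      act := fun k => act (e k).1
      next := fun k => Finset.univ.filter fun j => R (e k) (e j) }
  have hnext : ∀ k q', (∃ b, T.trans (e k).1.1 (act (e k).1) b q') →
      ∃ j ∈ RP.next k, RP.state j = q' := by
    rintro k q' ⟨b, hb⟩
    let w : W := ⟨(q', δ (e k).1.2 (val (e k).1.1)), (hact _ (e k).2 b q' hb).1⟩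
    refine ⟨e.symm w, ?_, ?_⟩
    · simp only [RP, R, Finset.mem_filter, Finset.mem_univ, true_and, e.apply_symm_apply]
      exact ⟨⟨b, hb⟩, rfl⟩
    · simp [RP, w]
  refine ⟨RP, ⟨?_, fun k => T.agent_executable _ _ _, ?_, ?_⟩, ?_, ?_⟩
  · change (e 0).1.1 = q
    rw [he]
  · intro k j hj
    rw [T.agent_step]
    exact (Finset.mem_filter.1 hj).2.1
  · intro k q' h
    exact hnext k q' ((T.agent_step _ _ _ _).1 h)
  · rintro σ ⟨ν, h0, hν⟩
    rw [hsat]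
    have hR : ∀ i, R (e (ν i)) (e (ν (i + 1))) := fun i => (Finset.mem_filter.1 (hν i).1).2
    have hst : ∀ i, (e (ν i)).1.1 = σ i := fun i => (hν i).2
    have hrun : ∀ i, (e (ν i)).1.2 = detRun δ x₀ (fun i => val (σ i)) i := by
      intro i
      induction i with
      | zero => rw [h0, he]; rfl
      | succ i ih => rw [(hR i).2, ih, hst i]; rfl
    simp only [← hrun]
    refine frequently_of_rank (r := fun i => rank (e (ν i)).1) fun i => ?_
    obtain ⟨⟨b, hb⟩, hx⟩ := hR i
    have := (hact _ (e (ν i)).2 b _ hb).2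
    rw [← hx] at this
    exact this
  -- Non-blocking and a disturbance label give every plan state a successor, so a trajectory exists.
  · have hex : ∀ k, ∃ j, j ∈ RP.next k := fun k => by
      obtain ⟨q', hq'⟩ := hnb (e k).1.1 (act (e k).1) (Classical.arbitrary B)
      obtain ⟨j, hj, -⟩ := hnext k q' ⟨_, hq'⟩
      exact ⟨j, hj⟩
    choose g hg using hex
    let ν : ℕ → Fin (n + 1) := fun i => Nat.rec 0 (fun _ k => g k) i
    exact ⟨fun i => RP.state (ν i), ν, rfl, fun i => ⟨hg _, rfl⟩⟩

/-! ### Simplification of plans -/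

namespace ReactivePlan

variable {Q A : Type*}

theorem isPath_of_sequence (RP : ReactivePlan Q A) {ν : ℕ → Fin (RP.last + 1)}
    (hν : ∀ i, ν (i + 1) ∈ RP.next (ν i)) {i j : ℕ} (hij : i < j) :
    ∃ s, RP.IsPath (ν i) (ν j) s := by
  obtain ⟨d, rfl⟩ : ∃ d, j = i + (d + 1) := ⟨j - i - 1, by omega⟩
  refine ⟨(List.range (d + 2)).map fun k => ν (i + k), by simp, ?_, ?_, ?_⟩
  · rw [List.isChain_iff_getElem]
    intro k hk
    simpa [add_assoc] using hν (i + k)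
  · simp [List.range_succ_eq_map]
  · simp [List.range_succ]

theorem exists_isShortestPath (RP : ReactivePlan Q A) {i j : Fin (RP.last + 1)}
    (h : ∃ s, RP.IsPath i j s) : ∃ s, RP.IsShortestPath i j s := by
  classical
  have hex : ∃ n s, RP.IsPath i j s ∧ s.length = n := h.elim fun s hs => ⟨_, s, hs, rfl⟩
  obtain ⟨s, hs, hlen⟩ := Nat.find_spec hex
  exact ⟨s, hs, fun t ht => hlen ▸ Nat.find_min' hex ⟨t, ht, rfl⟩⟩

/-- An infinite sequence in a finite plan repeats a plan state, which is then reachable and on a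
cycle. -/
theorem Generates.exists_findsCycle {RP : ReactivePlan Q A} {σ : ℕ → Q} (h : RP.Generates σ) :
    ∃ pre suf, RP.FindsCycle pre suf := by
  obtain ⟨ν, h0, hν⟩ := h
  let C : Set (Fin (RP.last + 1)) := {i | (∃ s, RP.IsPath i i s) ∧ ∃ s, RP.IsPath 0 i s}
  have hC : C.Nonempty := by
    obtain ⟨i, j, hij, heq⟩ : ∃ i j, i < j ∧ ν i = ν j := by
      obtain ⟨i, j, hne, heq⟩ := Finite.exists_ne_map_eq_of_infinite ν
      rcases hne.lt_or_gt with h | h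
      exacts [⟨i, j, h, heq⟩, ⟨j, i, h, heq.symm⟩]
    refine ⟨ν j, ?_, ?_⟩
    · have := RP.isPath_of_sequence (fun i => (hν i).1) hij
      rwa [heq] at this
    · have := RP.isPath_of_sequence (fun i => (hν i).1) (Nat.zero_lt_of_lt hij)
      rwa [h0] at this
  obtain ⟨i, hi, hmin⟩ := wellFounded_lt.has_min C hC
  obtain ⟨suf, hsuf⟩ := RP.exists_isShortestPath hi.1
  obtain ⟨pre, hpre⟩ := RP.exists_isShortestPath hi.2
  exact ⟨pre, suf, i, hsuf, hpre, fun i' hlt hi' => hmin i' hi' hlt⟩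

theorem exists_isPruning (RP : ReactivePlan Q A) (pre suf : List (Fin (RP.last + 1)))
    (i : Fin (RP.last + 1)) : ∃ N', RP.IsPruning pre suf i N' := by
  classical
  have key : ∀ q, ∃ l, (∃ j ∈ RP.next i, RP.state j = q) → l ∈ RP.next i ∧ RP.state l = q ∧
      (Consecutive pre i l ∨ (¬ ∃ j ∈ RP.next i, RP.state j = q ∧ Consecutive pre i j) ∧
        (Consecutive suf i l ∨
          ¬ ∃ j ∈ RP.next i, RP.state j = q ∧ Consecutive suf i j)) := by
    intro q
    by_cases hp : ∃ j ∈ RP.next i, RP.state j = q ∧ Consecutive pre i j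
    · obtain ⟨l, hl, hq, hc⟩ := hp
      exact ⟨l, fun _ => ⟨hl, hq, Or.inl hc⟩⟩
    by_cases hs : ∃ j ∈ RP.next i, RP.state j = q ∧ Consecutive suf i j
    · obtain ⟨l, hl, hq, hc⟩ := hs
      exact ⟨l, fun _ => ⟨hl, hq, Or.inr ⟨hp, Or.inl hc⟩⟩⟩
    by_cases hn : ∃ j ∈ RP.next i, RP.state j = q
    · obtain ⟨l, hl, hq⟩ := hn
      exact ⟨l, fun _ => ⟨hl, hq, Or.inr ⟨hp, Or.inr hs⟩⟩⟩
    · exact ⟨0, fun h => (hn h).elim⟩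
  choose l hl using key
  -- Keep exactly the successors that are the chosen representatives of their own labels.
  refine ⟨(RP.next i).filter fun j => j = l (RP.state j), Finset.filter_subset _ _, ?_⟩
  intro q hq
  obtain ⟨h1, h2, h3⟩ := hl q hq
  refine ⟨l q, h1, h2, fun j hj hjq => ?_, h3⟩
  rw [Finset.mem_filter, hjq]
  exact and_iff_right hj

theorem Generates.exists_simplifiesTo {RP : ReactivePlan Q A} {σ : ℕ → Q} (h : RP.Generates σ) :
    ∃ RP', RP.SimplifiesTo RP' := by
  obtain ⟨pre, suf, hc⟩ := h.exists_findsCycle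
  choose N' hN' using RP.exists_isPruning pre suf
  exact ⟨_, pre, suf, hc, N', hN', rfl⟩

theorem Generates.of_simplifiesTo {RP RP' : ReactivePlan Q A} (h : RP.SimplifiesTo RP')
    {σ : ℕ → Q} (hσ : RP'.Generates σ) : RP.Generates σ := by
  obtain ⟨pre, suf, -, N', hN', rfl⟩ := h
  obtain ⟨ν, h0, hν⟩ := hσ
  exact ⟨ν, h0, fun i => ⟨(hN' _).1 (hν i).1, (hν i).2⟩⟩

theorem IsPlanOf.of_simplifiesTo {RP RP' : ReactivePlan Q A} (h : RP.SimplifiesTo RP')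
    {R : ReactiveAgent Q A} (hR : RP.IsPlanOf R) : RP'.IsPlanOf R := by
  obtain ⟨pre, suf, -, N', hN', rfl⟩ := h
  obtain ⟨h1, h2, h3, h4⟩ := hR
  refine ⟨h1, h2, fun n j hj => h3 n j ((hN' n).1 hj), fun n q' hq' => ?_⟩
  obtain ⟨l, hl, hlq, hiff, -⟩ := (hN' n).2 q' (h4 n q' hq')
  exact ⟨l, (hiff l hl hlq).2 rfl, hlq⟩

/-! ### The strategy of a plan -/

open Classical in
/-- The plan state reached from `k` by following the successors labelled by `σ 1, σ 2, …`. -/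
noncomputable def track (RP : ReactivePlan Q A) (σ : ℕ → Q) (k : Fin (RP.last + 1)) :
    ℕ → Fin (RP.last + 1)
  | 0 => k
  | i + 1 =>
    if h : ∃ j, j ∈ RP.next (RP.track σ k i) ∧ RP.state j = σ (i + 1) then h.choose else 0

theorem track_spec (RP : ReactivePlan Q A) {σ : ℕ → Q} {k : Fin (RP.last + 1)} {i : ℕ}
    (h : ∃ j, j ∈ RP.next (RP.track σ k i) ∧ RP.state j = σ (i + 1)) :
    RP.track σ k (i + 1) ∈ RP.next (RP.track σ k i) ∧
      RP.state (RP.track σ k (i + 1)) = σ (i + 1) := by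
  rw [track, dif_pos h]
  exact h.choose_spec

theorem track_succ' (RP : ReactivePlan Q A) (σ : ℕ → Q) (k : Fin (RP.last + 1)) (i : ℕ) :
    RP.track σ k (i + 1) = RP.track (fun n => σ (n + 1)) (RP.track σ k 1) i := by
  induction i with
  | zero => rfl
  | succ i ih => rw [track, ih, ← track]

/-- `follow` consumes the string from the front while `track` grows at the end; `track_succ'`
reconciles them. Both select successors by the same `choose`, so no uniqueness of successors is
needed. -/
theorem follow_eq_act_track (RP : ReactivePlan Q A) (i : ℕ) (σ : ℕ → Q) (k : Fin (RP.last + 1))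
    (h : ∀ m < i, ∃ j, j ∈ RP.next (RP.track σ k m) ∧ RP.state j = σ (m + 1)) :
    RP.follow k ((List.range i).map fun n => σ (n + 1)) = RP.act (RP.track σ k i) := by
  induction i generalizing σ k with
  | zero => rfl
  | succ i ih =>
    have h0 : ∃ j, j ∈ RP.next k ∧ RP.state j = σ 1 := h 0 (Nat.succ_pos i)
    have ht : RP.track σ k 1 = h0.choose := dif_pos h0
    rw [List.range_succ_eq_map, List.map_cons, List.map_map, follow, dif_pos h0, track_succ', ht]
    refine ih (fun n => σ (n + 1)) _ fun m hm => ?_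
    rw [← ht, ← track_succ']
    exact h (m + 1) (by omega)

/-- Every outcome of the strategy of a plan is generated by the plan. -/
theorem generates_of_mem_out {B O : Type*} [Fintype A] {T : AltTransSystem Q A B O} {q₀ : Q}
    {RP : ReactivePlan Q A} (hRP : RP.IsPlanOf (T.agent q₀)) {σ : ℕ → Q}
    (hσ : σ ∈ T.Out q₀ RP.functionStrategy) : RP.Generates σ := by
  obtain ⟨h1, -, -, h4⟩ := hRP
  obtain ⟨h0, hstep⟩ := hσ
  have hstart : σ 0 = RP.state 0 := h0.trans h1.symm
  have hlabel : ∀ i, (∀ m < i, ∃ j, j ∈ RP.next (RP.track σ 0 m) ∧ RP.state j = σ (m + 1)) →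
      RP.state (RP.track σ 0 i) = σ i := fun i hi => by
    cases i with
    | zero => exact hstart.symm
    | succ i => exact (RP.track_spec (hi i (Nat.lt_succ_self i))).2
  -- Strong induction, since the strategy's value at time `i` is known only once all earlier moves
  -- have been tracked in the plan.
  have key : ∀ i, ∃ j, j ∈ RP.next (RP.track σ 0 i) ∧ RP.state j = σ (i + 1) := by
    intro i
    induction i using Nat.strong_induction_on with
    | _ i ih =>
      obtain ⟨b, hb⟩ := hstep i
      have hact : RP.functionStrategy (initialSegment σ i) = RP.act (RP.track σ 0 i) := by
        rw [← RP.follow_eq_act_track i σ 0 ih]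
        simp [functionStrategy, initialSegment, List.range_succ_eq_map, hstart,
          Function.comp_def]
      rw [hact, ← hlabel i ih] at hb
      exact h4 _ _ ((T.agent_step _ _ _ _).2 ⟨b, hb⟩)
  exact ⟨RP.track σ 0, rfl, fun i => ⟨(RP.track_spec (key i)).1, hlabel i fun m _ => key m⟩⟩

end ReactivePlan

/-! ### The algorithm -/

section Algorithm

variable {Q A B O P : Type*} [Fintype A] {T : AltTransSystem Q A B O} {φ : LTL P}
  {val : Q → Set P}

theorem exists_algorithmReturns (T : AltTransSystem Q A B O) (φ : LTL P) (val : Q → Set P)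
    (qs : List Q) : ∃ r, AlgorithmReturns T φ val qs r := by
  induction qs with
  | nil => exact ⟨_, .exhausted⟩
  | cons q₀ qs ih =>
    by_cases hex : ∃ RP : ReactivePlan Q A, RP.IsPlanOf (T.agent q₀) ∧ RP.Satisfies val φ
    · obtain ⟨RP, hplan, hsat⟩ := hex
      obtain ⟨σ, hσ⟩ := hsat.2
      obtain ⟨RP', hRP'⟩ := hσ.exists_simplifiesTo
      exact ⟨_, .found q₀ qs RP RP' (.found RP hplan hsat) hRP'⟩
    · obtain ⟨r, hr⟩ := ih
      exact ⟨r, .continue q₀ qs r (.failed fun RP h h' => hex ⟨RP, h, h'⟩) hr⟩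

/-- Soundness: a strategy returned by the algorithm enforces the formula. -/
theorem AlgorithmReturns.sound {qs : List Q} {r : Option (Q × Strategy Q A)}
    (h : AlgorithmReturns T φ val qs r) :
    ∀ p ∈ r, ∀ σ ∈ T.Out p.1 p.2, SeqSat val σ φ := by
  induction h with
  | exhausted => simp
  | found q₀ qs RPkab RP hplan hsimp =>
    rintro p hp σ hσ
    obtain rfl := Option.some.inj hp
    cases hplan with
    | found _ hplan hsat =>
      exact hsat.1 σ (.of_simplifiesTo hsimp
        (ReactivePlan.generates_of_mem_out (hplan.of_simplifiesTo hsimp) hσ))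
  | _ q₀ qs r hfail hrest ih => exact ih

/-- The loop may stop before `q`, but it cannot get past `q`: failure there would deny the existing
plan. -/
theorem AlgorithmReturns.ne_none {qs : List Q} {r : Option (Q × Strategy Q A)}
    (h : AlgorithmReturns T φ val qs r) {q : Q} (hq : q ∈ qs)
    (hex : ∃ RP : ReactivePlan Q A, RP.IsPlanOf (T.agent q) ∧ RP.Satisfies val φ) :
    r ≠ none := by
  induction h with
  | exhausted => simp at hq
  | found => simp
  | _ q₀ qs r hfail hrest ih =>
    rcases List.mem_cons.1 hq with rfl | hq
    · cases hfail with
      | failed hno =>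
        obtain ⟨RP, hplan, hsat⟩ := hex
        exact (hno RP hplan hsat).elim
    · exact ih hq

end Algorithm

end ControlStrategy

open ControlStrategy in
/-- Completeness of the control strategy algorithm with respect to total formulas. Here `order` is
the order in which the algorithm goes through the states. Every run of the algorithm ends with an
initial state and a control strategy enforcing `φ`, and there is such a run. -/
theorem mainTheorem1 {Q A B O P : Type*} [Fintype A] [Nonempty B] [Finite P]
    (T : AltTransSystem Q A B O) (hfin : T.IsFinite) (hnb : T.NonBlocking)
    (φ : LTL P) (val : Q → Set P) (hφ : φ.IsTotal)
    (h : ∃ (q : Q) (f : Strategy Q A), ∀ σ ∈ T.Out q f, SeqSat val σ φ)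
    (order : List Q) (hnodup : order.Nodup) (horder : ∀ q, q ∈ order) :
    (∃ r, AlgorithmReturns T φ val order r) ∧
      ∀ r, AlgorithmReturns T φ val order r →
        ∃ (q' : Q) (f' : Strategy Q A), r = some (q', f') ∧ ∀ σ ∈ T.Out q' f', SeqSat val σ φ := by
  have : Finite Q := hfin.1
  refine ⟨exists_algorithmReturns T φ val order, fun r hr => ?_⟩
  obtain ⟨q, f, hf⟩ := h
  obtain ⟨⟨q', f'⟩, rfl⟩ := Option.ne_none_iff_exists'.1
    (hr.ne_none (horder q) (exists_plan T hnb φ val hφ q f hf))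
  exact ⟨q', f', rfl, hr.sound _ rfl⟩
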